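/- A partition of a positive integer $n$ is a sequence of integers $\lambda_1\ge\lambda_2\ge\cdots\ge\lambda_k>0$ with sum $n$; the $\lambda_i$ are its parts. Let $p_{od}^{eu}(n)$ be the number of partitions of $n$ in which all even parts are greater than all odd parts, the odd parts are distinct and the even parts are unrestricted. Let $p_{eu}^{od}(n)$ be the number of partitions of $n$ in which all odd parts are greater than all even parts, the odd parts are distinct and the even parts are unrestricted. In both cases partitions without even parts or without odd parts are allowed. Then for every integer $n\ge 373$, $$p_{od}^{eu}(n)<p_{eu}^{od}(n).$$ -/

import Mathlib

/-- The partitions of `n` whose odd parts are pairwise distinct, whose even parts are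
unrestricted, and in which every even part is larger than every odd part. Having no even parts
or no odd parts is allowed. -/
def partitionsOdEu (n : ℕ) : Finset n.Partition :=
  Finset.univ.filter fun p =>
    (p.parts.filter fun a => Odd a).Nodup ∧
      ∀ a ∈ p.parts, ∀ b ∈ p.parts, Even a → Odd b → b < a

/-- The partitions of `n` whose odd parts are pairwise distinct, whose even parts are
unrestricted, and in which every odd part is larger than every even part. Having no even parts
or no odd parts is allowed. -/
def partitionsEuOd (n : ℕ) : Finset n.Partition :=
  Finset.univ.filter fun p =>
    (p.parts.filter fun a => Odd a).Nodup ∧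
      ∀ a ∈ p.parts, ∀ b ∈ p.parts, Even a → Odd b → a < b

/-- The number $p_{od}^{eu}(n)$. -/
def pOdEu (n : ℕ) : ℕ := (partitionsOdEu n).card

/-- The number $p_{eu}^{od}(n)$. -/
def pEuOd (n : ℕ) : ℕ := (partitionsEuOd n).card

/-!
Grouping each class by the number `k` of odd parts turns the inequality into a comparison with the
partition function `p`.

In the second class (odd parts above even parts), the members with `k` odd parts are counted by
`p((n - k ^ 2) / 2)`; only the lower bound is needed, and `countPartsLE_le_countEuOd` proves it by
removing the largest possible odd part.

In the first class (even parts above odd parts), assign to each odd number missing below the largest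
odd part the number of odd parts above it. This gives a partition into parts at most `k`; together
with the halved even parts it forms a partition of `(n - k ^ 2) / 2` in which every part larger
than `k` exceeds `k` by at least the number `l` of parts up to `k`. Only partitions with all
parts at least `k` and with a part `k` can arise twice, while no partition containing `k + 1, 1, 1`
arises if `k ≥ 2` (`countGap_add_countGap_le`). For `k ≥ 4`, lowering the smallest part by three
shows that the loss outweighs the gain, up to a single partition occurring for at most one `k`
(`oddCountOdEu_le_oddCountEuOd`). Hence the cases `k ≤ 3` have to provide a surplus of two. There
the gains are bounded by numbers of partitions without the part `1`, and what remains is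
`q(n) + q(n - 1) + q(n - 7) + 2 ≤ p(n - 10)` for `q(n) = p(n) - p(n - 1)`.

This last inequality says that partitions without the part `1` are rare. The difference `a(n)` of
its two sides satisfies `n a(n) ≥ ∑ σ(m) a(n - m)`, a consequence of Euler's recurrence
`n p(n) = ∑ σ(m) p(n - m)`. Since `m ≤ σ(m) ≤ m ^ 2`, the finitely many negative values of `a`
are dominated by the positive ones as soon as these are large on a long enough interval, which is
checked on a table of values of `p` (`le_onesExcess`).
-/

/-! ### Counting multisets of positive integers with a given sum -/

/-- The partitions of `n`, encoded as the multisets of positive integers with sum `n`. -/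
def partitionMultisets (n : ℕ) : Finset (Multiset ℕ) :=
  Finset.univ.image fun p : n.Partition => p.parts

theorem mem_partitionMultisets {n : ℕ} {s : Multiset ℕ} :
    s ∈ partitionMultisets n ↔ 0 ∉ s ∧ s.sum = n := by
  constructor
  · intro h
    obtain ⟨p, -, rfl⟩ := Finset.mem_image.1 h
    exact ⟨fun h0 => (p.parts_pos h0).ne rfl, p.parts_sum⟩
  · rintro ⟨h0, hs⟩
    exact Finset.mem_image.2 ⟨⟨s, fun {i} hi => Nat.pos_of_ne_zero fun h => h0 (h ▸ hi), hs⟩,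
      Finset.mem_univ _, rfl⟩

open Classical in
/-- The number of partitions of `n` whose multiset of parts satisfies `P`. -/
noncomputable def partitionCount (P : Multiset ℕ → Prop) (n : ℕ) : ℕ :=
  ((partitionMultisets n).filter P).card

open Classical in
theorem card_filter_partition (P : Multiset ℕ → Prop) (n : ℕ) :
    (Finset.univ.filter fun p : n.Partition => P p.parts).card = partitionCount P n := by
  unfold partitionCount partitionMultisets
  rw [Finset.filter_image, Finset.card_image_of_injective _ fun p q h => Nat.Partition.ext h]

theorem partitionCount_mono {P Q : Multiset ℕ → Prop} {n : ℕ}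
    (h : ∀ s, 0 ∉ s → s.sum = n → P s → Q s) : partitionCount P n ≤ partitionCount Q n := by
  classical
  refine Finset.card_le_card fun s hs => ?_
  rw [Finset.mem_filter, mem_partitionMultisets] at hs ⊢
  exact ⟨hs.1, h s hs.1.1 hs.1.2 hs.2⟩

theorem partitionCount_congr {P Q : Multiset ℕ → Prop} {n : ℕ}
    (h : ∀ s, 0 ∉ s → s.sum = n → (P s ↔ Q s)) : partitionCount P n = partitionCount Q n :=
  le_antisymm (partitionCount_mono fun s h0 hn => (h s h0 hn).1)
    (partitionCount_mono fun s h0 hn => (h s h0 hn).2)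

theorem partitionCount_eq_zero {P : Multiset ℕ → Prop} {n : ℕ}
    (h : ∀ s, 0 ∉ s → s.sum = n → ¬ P s) : partitionCount P n = 0 := by
  classical
  refine Finset.card_eq_zero.2 (Finset.filter_eq_empty_iff.2 fun s hs => ?_)
  rw [mem_partitionMultisets] at hs
  exact h s hs.1 hs.2

theorem partitionCount_split (P R : Multiset ℕ → Prop) (n : ℕ) :
    partitionCount P n =
      partitionCount (fun s => R s ∧ P s) n + partitionCount (fun s => ¬ R s ∧ P s) n := by
  classical
  unfold partitionCount
  rw [← Finset.card_filter_add_card_filter_not (s := (partitionMultisets n).filter P) R,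
    Finset.filter_filter, Finset.filter_filter]
  simp only [and_comm]

theorem partitionCount_add_le {P Q R : Multiset ℕ → Prop} {n : ℕ}
    (hP : ∀ s, 0 ∉ s → s.sum = n → P s → R s ∧ ¬ Q s)
    (hQ : ∀ s, 0 ∉ s → s.sum = n → Q s → R s) :
    partitionCount P n + partitionCount Q n ≤ partitionCount R n := by
  rw [partitionCount_split R Q n, add_comm]
  exact add_le_add (partitionCount_mono fun s h0 hn h => ⟨h, hQ s h0 hn h⟩)
    (partitionCount_mono fun s h0 hn h => ⟨(hP s h0 hn h).2, (hP s h0 hn h).1⟩)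

/-- Removing a prescribed submultiset `t` of the parts. -/
theorem partitionCount_le_and (t : Multiset ℕ) (ht : 0 ∉ t) (P : Multiset ℕ → Prop) (n : ℕ) :
    partitionCount (fun s => t ≤ s ∧ P s) (n + t.sum) = partitionCount (fun s => P (t + s)) n := by
  classical
  symm
  refine Finset.card_bij (fun s _ => t + s) ?_ ?_ ?_
  · intro s hs
    simp only [Finset.mem_filter, mem_partitionMultisets, Multiset.mem_add, Multiset.sum_add]
      at hs ⊢
    exact ⟨⟨by tauto, by omega⟩, Multiset.le_add_right _ _, hs.2⟩
  · intro s _ s' _ h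
    exact add_left_cancel h
  · intro s hs
    simp only [Finset.mem_filter, mem_partitionMultisets] at hs
    obtain ⟨⟨h0, hn⟩, hts, hP⟩ := hs
    obtain ⟨u, rfl⟩ := Multiset.le_iff_exists_add.1 hts
    refine ⟨u, ?_, rfl⟩
    simp only [Finset.mem_filter, mem_partitionMultisets, Multiset.mem_add, Multiset.sum_add]
      at h0 hn ⊢
    exact ⟨⟨by tauto, by omega⟩, hP⟩

/-- Removing one copy of a prescribed part `a`. -/
theorem partitionCount_mem_and {a : ℕ} (ha : a ≠ 0) (P : Multiset ℕ → Prop) (n : ℕ) :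
    partitionCount (fun s => a ∈ s ∧ P s) (n + a) = partitionCount (fun s => P (a ::ₘ s)) n := by
  have := partitionCount_le_and {a} (by simpa using ha.symm) P n
  simpa [Multiset.singleton_le, Multiset.singleton_add] using this

/-- The partition function. -/
noncomputable def partitionNumber (n : ℕ) : ℕ := partitionCount (fun _ => True) n

theorem partitionCount_le_partitionNumber (P : Multiset ℕ → Prop) (n : ℕ) :
    partitionCount P n ≤ partitionNumber n :=
  partitionCount_mono fun _ _ _ _ => trivial

theorem partitionCount_le (t : Multiset ℕ) (ht : 0 ∉ t) (n : ℕ) :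
    partitionCount (fun s => t ≤ s) (n + t.sum) = partitionNumber n := by
  unfold partitionNumber
  simpa using partitionCount_le_and t ht (fun _ => True) n

theorem partitionNumber_zero : partitionNumber 0 = 1 := by
  classical
  unfold partitionNumber partitionCount
  refine Finset.card_eq_one.2 ⟨0, ?_⟩
  ext s
  simp only [Finset.filter_true, mem_partitionMultisets, Finset.mem_singleton]
  constructor
  · rintro ⟨h0, hs⟩
    refine Multiset.eq_zero_of_forall_notMem fun a ha => ?_
    have := Multiset.le_sum_of_mem ha
    have : a = 0 := by omega
    exact h0 (this ▸ ha)
  · rintro rfl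
    simp

/-! ### Partitions with bounded smallest part -/

/-- The number of partitions of `n` into parts that are at least `k`. -/
noncomputable def countPartsGE (k n : ℕ) : ℕ := partitionCount (fun s => ∀ x ∈ s, k ≤ x) n

theorem countPartsGE_add {k : ℕ} (hk : k ≠ 0) (n : ℕ) :
    countPartsGE k (n + k) = countPartsGE (k + 1) (n + k) + countPartsGE k n := by
  unfold countPartsGE
  rw [partitionCount_split _ (fun s => k ∈ s), partitionCount_mem_and hk, add_comm]
  congr 1
  · refine partitionCount_congr fun s _ _ => ⟨fun h x hx => ?_, fun h => ⟨fun hk => ?_, ?_⟩⟩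
    · have := h.2 x hx
      have : x ≠ k := fun e => h.1 (e ▸ hx)
      omega
    · have := h k hk
      omega
    · intro x hx
      have := h x hx
      omega
  · exact partitionCount_congr fun s _ _ => by simp

theorem countPartsGE_anti {k l : ℕ} (h : k ≤ l) (n : ℕ) : countPartsGE l n ≤ countPartsGE k n :=
  partitionCount_mono fun _ _ _ hs x hx => h.trans (hs x hx)

theorem countPartsGE_eq_zero {k n : ℕ} (hn : n ≠ 0) (h : n < k) : countPartsGE k n = 0 := by
  refine partitionCount_eq_zero fun s _ hs hk => ?_
  obtain rfl | ⟨x, hx⟩ := s.empty_or_exists_mem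
  · simp at hs
    omega
  · have := Multiset.le_sum_of_mem hx
    have := hk x hx
    omega

theorem countPartsGE_one (n : ℕ) : countPartsGE 1 n = partitionNumber n :=
  partitionCount_congr fun _ h0 _ => ⟨fun _ => trivial, fun _ _ hx =>
    Nat.pos_of_ne_zero fun h => h0 (h ▸ hx)⟩

theorem countPartsGE_zero_right (k : ℕ) : countPartsGE k 0 ≤ 1 := by
  rw [← partitionNumber_zero]
  exact partitionCount_le_partitionNumber _ _

/-- The partitions counted by `p(n) - p(n - 1)` are those without the part `1`. -/
theorem partitionNumber_succ (n : ℕ) :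
    partitionNumber (n + 1) = countPartsGE 2 (n + 1) + partitionNumber n := by
  simpa only [countPartsGE_one] using countPartsGE_add one_ne_zero n

theorem partitionNumber_mono : Monotone partitionNumber :=
  monotone_nat_of_le_succ fun n => by
    rw [partitionNumber_succ]
    omega

/-- Lowering the smallest part by `d` is injective on nonempty partitions. -/
theorem countPartsGE_add_le {k : ℕ} (d n : ℕ) (hk : k ≠ 0) :
    countPartsGE (k + d) (n + d + 1) ≤ countPartsGE k (n + 1) := by
  induction h : n + 1 - k generalizing k with
  | zero =>
    by_cases hkn : n + 1 = k
    · subst hkn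
      have := countPartsGE_add (k := n + 1 + d) (by omega) 0
      rw [countPartsGE_eq_zero (k := n + 1 + d + 1) (by omega) (by omega)] at this
      have h2 := countPartsGE_add hk 0
      have h3 : countPartsGE (n + 1 + d) 0 = countPartsGE (n + 1) 0 :=
        partitionCount_congr fun s h0 hs => by
          have : s = 0 := Multiset.eq_zero_of_forall_notMem fun a ha => by
            have := Multiset.le_sum_of_mem ha
            exact h0 ((show a = 0 by omega) ▸ ha)
          simp [this]
      simp only [zero_add] at this h2
      rw [show n + d + 1 = n + 1 + d by omega]
      omega
    · rw [countPartsGE_eq_zero (by omega) (by omega)]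
      exact Nat.zero_le _
  | succ m ih =>
    obtain ⟨j, hj⟩ : ∃ j, n + 1 = j + k := ⟨n + 1 - k, by omega⟩
    have h1 := ih (k := k + 1) (by omega) (by omega)
    have h2 := countPartsGE_add (k := k + d) (by omega) j
    have h3 := countPartsGE_add hk j
    have h4 := countPartsGE_anti (show k ≤ k + d by omega) j
    rw [show n + d + 1 = j + (k + d) by omega] at *
    rw [hj] at *
    rw [show k + 1 + d = k + d + 1 by omega] at h1
    omega

/-! ### The recurrence of the partition function in terms of divisor sums -/

/-- The sum of the divisors of `m`. -/
def divisorSum (m : ℕ) : ℕ := ∑ d ∈ m.divisors, d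

theorem le_divisorSum (m : ℕ) : m ≤ divisorSum m := by
  obtain rfl | hm := eq_or_ne m 0
  · exact Nat.zero_le _
  · exact Finset.single_le_sum (f := fun d => d) (fun _ _ => Nat.zero_le _)
      (Nat.mem_divisors_self m hm)

theorem divisorSum_le_sq (m : ℕ) : divisorSum m ≤ m ^ 2 := by
  have := ArithmeticFunction.sigma_le_pow_succ 1 m
  rwa [ArithmeticFunction.sigma_one_apply] at this

/-- The contribution of the parts `k`, distributed over the multiples `m = k * j` with `j` at
most the multiplicity of `k`. -/
theorem mul_count_eq_sum {n k : ℕ} {s : Multiset ℕ} (hk : 0 < k) (hs : s.sum = n) :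
    s.count k * k =
      ∑ m ∈ Finset.Ioc 0 n, if k ∣ m ∧ m ≤ k * s.count k then k else 0 := by
  have hle : k * s.count k ≤ n := by
    have h := (Multiset.le_count_iff_replicate_le (a := k)).1 (le_refl (s.count k))
    obtain ⟨u, hu⟩ := Multiset.le_iff_exists_add.1 h
    have h2 := congrArg Multiset.sum hu
    rw [Multiset.sum_add, Multiset.sum_replicate, smul_eq_mul] at h2
    rw [mul_comm]
    omega
  rw [← Finset.sum_filter, Finset.sum_const, smul_eq_mul]
  congr 1
  have h3 := Nat.Ioc_filter_dvd_card_eq_div (k * s.count k) k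
  rw [Nat.mul_div_cancel_left _ hk] at h3
  refine h3.symm.trans (congrArg Finset.card ?_)
  ext m
  simp only [Finset.mem_filter, Finset.mem_Ioc]
  constructor
  · rintro ⟨⟨h1, h2⟩, h3⟩
    exact ⟨⟨h1, h2.trans hle⟩, h3, h2⟩
  · rintro ⟨⟨h1, h2⟩, h3, h4⟩
    exact ⟨⟨h1, h4⟩, h3⟩

/-- For `m = k * j`, the partitions of `n` with at least `j` parts `k` correspond to the
partitions of `n - m`. -/
theorem sum_ite_count {n k m : ℕ} (hk : 0 < k) (hm : m ≤ n) (hkm : k ∣ m) :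
    (∑ s ∈ partitionMultisets n, if k ∣ m ∧ m ≤ k * s.count k then k else 0) =
      k * partitionNumber (n - m) := by
  classical
  obtain ⟨j, rfl⟩ := hkm
  have h := partitionCount_le (Multiset.replicate j k)
    (fun h0 => hk.ne (Multiset.eq_of_mem_replicate h0)) (n - k * j)
  rw [Multiset.sum_replicate, smul_eq_mul, mul_comm j k, Nat.sub_add_cancel hm] at h
  rw [← h, ← Finset.sum_filter, Finset.sum_const, smul_eq_mul, mul_comm]
  congr 1
  unfold partitionCount
  congr 1
  ext s
  simp only [Finset.mem_filter, ← Multiset.le_count_iff_replicate_le]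
  simp [Nat.mul_le_mul_left_iff hk]

/-- Euler's recurrence `n p(n) = ∑ σ(m) p(n - m)`, obtained by counting the total size of all
partitions of `n` part by part. -/
theorem mul_partitionNumber (n : ℕ) :
    n * partitionNumber n =
      ∑ m ∈ Finset.Ioc 0 n, divisorSum m * partitionNumber (n - m) := by
  classical
  have h1 : n * partitionNumber n = ∑ s ∈ partitionMultisets n, s.sum := by
    rw [Finset.sum_congr rfl fun s hs => (mem_partitionMultisets.1 hs).2, Finset.sum_const,
      smul_eq_mul, mul_comm]
    simp [partitionNumber, partitionCount]
  have h2 : ∀ s ∈ partitionMultisets n, s.sum = ∑ k ∈ Finset.Ioc 0 n, ∑ m ∈ Finset.Ioc 0 n,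
      if k ∣ m ∧ m ≤ k * s.count k then k else 0 := by
    intro s hs
    obtain ⟨h0, hn⟩ := mem_partitionMultisets.1 hs
    rw [Finset.sum_multiset_count_of_subset s (Finset.Ioc 0 n)]
    · refine Finset.sum_congr rfl fun k hk => ?_
      rw [smul_eq_mul, mul_count_eq_sum (Finset.mem_Ioc.1 hk).1 hn]
    · intro k hk
      rw [Multiset.mem_toFinset] at hk
      exact Finset.mem_Ioc.2 ⟨Nat.pos_of_ne_zero fun h => h0 (h ▸ hk),
        hn ▸ Multiset.le_sum_of_mem hk⟩
  rw [h1, Finset.sum_congr rfl h2, Finset.sum_comm,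
    Finset.sum_congr rfl fun k _ => Finset.sum_comm, Finset.sum_comm]
  refine Finset.sum_congr rfl fun m hm => ?_
  rw [Finset.mem_Ioc] at hm
  rw [divisorSum, Finset.sum_mul]
  symm
  refine Finset.sum_subset_zero_on_sdiff (fun k hk => ?_) (fun k hk => ?_) (fun k hk => ?_)
  · have := Nat.divisor_le hk
    exact Finset.mem_Ioc.2 ⟨Nat.pos_of_mem_divisors hk, by omega⟩
  · rw [Finset.mem_sdiff, Nat.mem_divisors] at hk
    refine Finset.sum_eq_zero fun s _ => if_neg fun h => hk.2 ⟨h.1, by omega⟩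
  · exact (sum_ite_count (Nat.pos_of_mem_divisors hk) hm.2 (Nat.dvd_of_mem_divisors hk)).symm

/-! ### Values of the partition function -/

/-- The divisor sums `σ(1), σ(2), …, σ(183)`. -/
def divisorSumTable : List ℕ :=
   [1, 3, 4, 7, 6, 12, 8, 15, 13, 18, 12, 28, 14, 24, 24, 31, 18, 39, 20, 42, 32, 36, 24, 60, 31,
    42, 40, 56, 30, 72, 32, 63, 48, 54, 48, 91, 38, 60, 56, 90, 42, 96, 44, 84, 78, 72, 48, 124,
    57, 93, 72, 98, 54, 120, 72, 120, 80, 90, 60, 168, 62, 96, 104, 127, 84, 144, 68, 126, 96,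
    144, 72, 195, 74, 114, 124, 140, 96, 168, 80, 186, 121, 126, 84, 224, 108, 132, 120, 180, 90,
    234, 112, 168, 128, 144, 120, 252, 98, 171, 156, 217, 102, 216, 104, 210, 192, 162, 108, 280,
    110, 216, 152, 248, 114, 240, 144, 210, 182, 180, 144, 360, 133, 186, 168, 224, 156, 312, 128,
    255, 176, 252, 132, 336, 160, 204, 240, 270, 138, 288, 140, 336, 192, 216, 168, 403, 180, 222,
    228, 266, 150, 372, 152, 300, 234, 288, 192, 392, 158, 240, 216, 378, 192, 363, 164, 294, 288,
    252, 168, 480, 183, 324, 260, 308, 174, 360, 248, 372, 240, 270, 180, 546, 182, 336, 248]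

/-- The values `p(0), p(1), …, p(183)` of the partition function. -/
def partitionTable : List ℕ :=
   [1, 1, 2, 3, 5, 7, 11, 15, 22, 30, 42, 56, 77, 101, 135, 176, 231, 297, 385, 490, 627, 792,
    1002, 1255, 1575, 1958, 2436, 3010, 3718, 4565, 5604, 6842, 8349, 10143, 12310, 14883, 17977,
    21637, 26015, 31185, 37338, 44583, 53174, 63261, 75175, 89134, 105558, 124754, 147273, 173525,
    204226, 239943, 281589, 329931, 386155, 451276, 526823, 614154, 715220, 831820, 966467,
    1121505, 1300156, 1505499, 1741630, 2012558, 2323520, 2679689, 3087735, 3554345, 4087968,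
    4697205, 5392783, 6185689, 7089500, 8118264, 9289091, 10619863, 12132164, 13848650, 15796476,
    18004327, 20506255, 23338469, 26543660, 30167357, 34262962, 38887673, 44108109, 49995925,
    56634173, 64112359, 72533807, 82010177, 92669720, 104651419, 118114304, 133230930, 150198136,
    169229875, 190569292, 214481126, 241265379, 271248950, 304801365, 342325709, 384276336,
    431149389, 483502844, 541946240, 607163746, 679903203, 761002156, 851376628, 952050665,
    1064144451, 1188908248, 1327710076, 1482074143, 1653668665, 1844349560, 2056148051,
    2291320912, 2552338241, 2841940500, 3163127352, 3519222692, 3913864295, 4351078600,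
    4835271870, 5371315400, 5964539504, 6620830889, 7346629512, 8149040695, 9035836076,
    10015581680, 11097645016, 12292341831, 13610949895, 15065878135, 16670689208, 18440293320,
    20390982757, 22540654445, 24908858009, 27517052599, 30388671978, 33549419497, 37027355200,
    40853235313, 45060624582, 49686288421, 54770336324, 60356673280, 66493182097, 73232243759,
    80630964769, 88751778802, 97662728555, 107438159466, 118159068427, 129913904637, 142798995930,
    156919475295, 172389800255, 189334822579, 207890420102, 228204732751, 250438925115,
    274768617130, 301384802048, 330495499613, 362326859895, 397125074750, 435157697830,
    476715857290, 522115831195, 571701605655, 625846753120, 684957390936, 749474411781,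
    819876908323, 896684817527]

/-- The sum of the products of the corresponding entries of two lists. -/
def listDot : List ℕ → List ℕ → ℕ
  | a :: l, b :: l' => a * b + listDot l l'
  | _, _ => 0

/-- Whether the list `l` continues the values in `r`, which are listed in reverse order, by the
recurrence `mul_partitionNumber`. -/
def satisfiesRecurrence : List ℕ → List ℕ → Bool
  | _, [] => true
  | r, a :: l => r.length * a == listDot divisorSumTable r && satisfiesRecurrence (a :: r) l

theorem divisorSumTable_eq :
    divisorSumTable = (List.range 183).map fun m => divisorSum (m + 1) := by
  decide +kernel

theorem satisfiesRecurrence_partitionTable :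
    satisfiesRecurrence [1] partitionTable.tail = true := by
  decide +kernel

theorem listDot_eq_sum (l l' : List ℕ) (h : l'.length ≤ l.length) :
    listDot l l' = ∑ i ∈ Finset.range l'.length, l.getD i 0 * l'.getD i 0 := by
  induction l' generalizing l with
  | nil => cases l <;> simp [listDot]
  | cons b l' ih =>
    cases l with
    | nil => simp at h
    | cons a l =>
      rw [List.length_cons, Finset.sum_range_succ', listDot, ih l (by simpa using h), add_comm]
      simp

theorem getD_of_satisfiesRecurrence (l r : List ℕ) (h : satisfiesRecurrence r l = true)
    (hr : 0 < r.length) (hlen : r.length + l.length ≤ 184)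
    (hval : ∀ i < r.length, r.getD i 0 = partitionNumber (r.length - 1 - i)) :
    ∀ i < l.length, l.getD i 0 = partitionNumber (r.length + i) := by
  induction l generalizing r with
  | nil => intro i hi; simp at hi
  | cons a l ih =>
    rw [satisfiesRecurrence, Bool.and_eq_true, beq_iff_eq] at h
    rw [List.length_cons] at hlen
    have ha : a = partitionNumber r.length := by
      have htab : divisorSumTable.length = 183 := by simp [divisorSumTable_eq]
      have h1 := h.1
      rw [listDot_eq_sum _ _ (by omega)] at h1
      have h2 := mul_partitionNumber r.length
      rw [← Finset.Ico_add_one_add_one_eq_Ioc, Finset.sum_Ico_eq_sum_range] at h2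
      refine Nat.eq_of_mul_eq_mul_left hr (h1.trans (Eq.trans ?_ h2.symm))
      refine Finset.sum_congr (by simp) fun i hi => ?_
      rw [Finset.mem_range] at hi
      rw [hval i hi, divisorSumTable_eq, List.getD_eq_getElem _ _ (by simp; omega)]
      simp only [List.getElem_map, List.getElem_range]
      congr 2 <;> omega
    have key := ih (a :: r) h.2 (by simp) (by rw [List.length_cons]; omega) (by
      intro i hi
      cases i with
      | zero => simpa using ha
      | succ i =>
        rw [List.length_cons] at hi ⊢
        rw [List.getD_cons_succ, hval i (by omega)]
        congr 1
        omega)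
    intro i hi
    cases i with
    | zero => simpa using ha
    | succ i =>
      rw [List.length_cons] at hi
      rw [List.getD_cons_succ, key i (by omega), List.length_cons]
      congr 1
      omega

theorem partitionTable_getD {n : ℕ} (hn : n < 184) :
    partitionTable.getD n 0 = partitionNumber n := by
  cases n with
  | zero => rw [partitionNumber_zero]; rfl
  | succ n =>
    have hlen : partitionTable.tail.length = 183 := by decide +kernel
    have h := getD_of_satisfiesRecurrence _ _ satisfiesRecurrence_partitionTable (by simp)
      (by rw [hlen]; simp) (by simp [partitionNumber_zero]) n (by omega)
    rw [List.length_singleton, add_comm] at h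
    rw [← h]
    rfl

/-! ### Partitions without the part one are rare -/

/-- The number `p(n - d)`, which is zero if `n < d`. -/
noncomputable def shiftedPartitionNumber (d n : ℕ) : ℤ :=
  if d ≤ n then (partitionNumber (n - d) : ℤ) else 0

theorem mul_shiftedPartitionNumber (d n : ℕ) :
    n * shiftedPartitionNumber d n =
      ∑ m ∈ Finset.Ioc 0 n, (divisorSum m : ℤ) * shiftedPartitionNumber d (n - m) +
        d * shiftedPartitionNumber d n := by
  by_cases h : d ≤ n
  · have h1 : ∑ m ∈ Finset.Ioc 0 n, (divisorSum m : ℤ) * shiftedPartitionNumber d (n - m) =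
        ∑ m ∈ Finset.Ioc 0 (n - d), (divisorSum m : ℤ) * partitionNumber (n - d - m) := by
      symm
      refine Finset.sum_subset_zero_on_sdiff (Finset.Ioc_subset_Ioc_right (Nat.sub_le _ _))
        (fun m hm => ?_) (fun m hm => ?_)
      · simp only [Finset.mem_sdiff, Finset.mem_Ioc] at hm
        rw [shiftedPartitionNumber, if_neg (by omega), mul_zero]
      · rw [Finset.mem_Ioc] at hm
        rw [shiftedPartitionNumber, if_pos (by omega), Nat.sub_right_comm]
    have h2 := congrArg (Nat.cast : ℕ → ℤ) (mul_partitionNumber (n - d))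
    push_cast [Nat.cast_sub h] at h2
    rw [h1, ← h2, shiftedPartitionNumber, if_pos h]
    ring
  · have h1 : ∀ m, shiftedPartitionNumber d (n - m) = 0 := fun m => if_neg (by omega)
    have h0 := h1 0
    rw [Nat.sub_zero] at h0
    simp [h1, h0]

/-- The difference `p(n - 10) - q(n) - q(n - 1) - q(n - 7)`, where `q(n) = p(n) - p(n - 1)` is the
number of partitions of `n` without the part `1`. -/
noncomputable def onesExcess (n : ℕ) : ℤ :=
  shiftedPartitionNumber 10 n - shiftedPartitionNumber 0 n + shiftedPartitionNumber 2 n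
    - shiftedPartitionNumber 7 n + shiftedPartitionNumber 8 n

theorem partitionNumber_succ_le (n : ℕ) : partitionNumber (n + 1) ≤ 2 * partitionNumber n := by
  rw [partitionNumber_succ]
  cases n with
  | zero => rw [countPartsGE_eq_zero (by omega) (by omega)]; omega
  | succ n =>
    have := countPartsGE_add_le 1 n one_ne_zero
    rw [countPartsGE_one] at this
    simp only [Nat.reduceAdd, add_assoc] at this ⊢
    omega

/-- Multiplying a shift of `p` by `n` adds `d * p(n - d)` to its convolution with `σ`. For the
combination in `onesExcess` these additional terms sum to a nonnegative number. -/
theorem le_mul_onesExcess {n : ℕ} (hn : 10 ≤ n) :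
    ∑ m ∈ Finset.range n, (divisorSum (n - m) : ℤ) * onesExcess m ≤ n * onesExcess n := by
  have h0 : ∑ m ∈ Finset.range n, (divisorSum (n - m) : ℤ) * onesExcess m =
      ∑ m ∈ Finset.Ioc 0 n, (divisorSum m : ℤ) * onesExcess (n - m) := by
    refine Finset.sum_nbij' (fun m => n - m) (fun m => n - m) ?_ ?_ ?_ ?_ ?_
    · intro m hm
      simp only [Finset.mem_range, Finset.mem_Ioc] at *
      omega
    · intro m hm
      simp only [Finset.mem_range, Finset.mem_Ioc] at *
      omega
    · intro m hm
      simp only [Finset.mem_range] at *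
      omega
    · intro m hm
      simp only [Finset.mem_Ioc] at *
      omega
    · intro m hm
      simp only [Finset.mem_range] at *
      rw [Nat.sub_sub_self hm.le]
  have h1 := mul_shiftedPartitionNumber 10 n
  have h2 := mul_shiftedPartitionNumber 0 n
  have h3 := mul_shiftedPartitionNumber 2 n
  have h4 := mul_shiftedPartitionNumber 7 n
  have h5 := mul_shiftedPartitionNumber 8 n
  have hs : ∀ d, d ≤ n → shiftedPartitionNumber d n = partitionNumber (n - d) :=
    fun d hd => if_pos hd
  have e1 : partitionNumber (n - 7) ≤ partitionNumber (n - 2) := partitionNumber_mono (by omega)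
  have e2 := partitionNumber_succ_le (n - 8)
  have e3 := partitionNumber_succ_le (n - 9)
  have e4 := partitionNumber_succ_le (n - 10)
  rw [show n - 8 + 1 = n - 7 by omega] at e2
  rw [show n - 9 + 1 = n - 8 by omega] at e3
  rw [show n - 10 + 1 = n - 9 by omega] at e4
  rw [h0]
  simp only [onesExcess, mul_add, mul_sub, Finset.sum_add_distrib, Finset.sum_sub_distrib]
  rw [h1, h2, h3, h4, h5, hs 10 hn, hs 0 (by omega), hs 2 (by omega), hs 7 (by omega),
    hs 8 (by omega)]
  push_cast
  linarith

/-- The value of `onesExcess` computed from the table of partition numbers. -/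
def tableExcess (n : ℕ) : ℤ :=
  let f : ℕ → ℤ := fun d => if d ≤ n then (partitionTable.getD (n - d) 0 : ℤ) else 0
  f 10 - f 0 + f 2 - f 7 + f 8

theorem onesExcess_eq {n : ℕ} (hn : n < 184) : onesExcess n = tableExcess n := by
  have h : ∀ d, shiftedPartitionNumber d n =
      if d ≤ n then (partitionTable.getD (n - d) 0 : ℤ) else 0 := fun d => by
    unfold shiftedPartitionNumber
    rw [partitionTable_getD (by omega)]
  simp only [onesExcess, tableExcess, h]

theorem le_tableExcess : ∀ n ∈ List.range 184, 120 ≤ n → 150000000 ≤ tableExcess n := by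
  decide +kernel

theorem sum_map_neg_tableExcess :
    ((List.range 120).map fun n => max 0 (-tableExcess n)).sum = 7500762 := by
  decide +kernel

theorem sum_map_list_range (f : ℕ → ℤ) (n : ℕ) :
    ((List.range n).map f).sum = ∑ i ∈ Finset.range n, f i := rfl

theorem sum_neg_onesExcess : ∑ m ∈ Finset.range 120, max 0 (-onesExcess m) = 7500762 := by
  rw [← sum_map_neg_tableExcess, sum_map_list_range]
  refine Finset.sum_congr rfl fun m hm => ?_
  rw [onesExcess_eq ((Finset.mem_range.1 hm).trans (by norm_num))]

/-- In the recurrence `le_mul_onesExcess`, the negative values of `onesExcess`, all of them at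
arguments below `120`, have total weight at most `7500762 n ^ 2`, while the values from `120` on
contribute at least `75000000 (n - 120) (n - 119)`. -/
theorem le_onesExcess {n : ℕ} (hn : 120 ≤ n) : 150000000 ≤ onesExcess n := by
  induction n using Nat.strong_induction_on with
  | _ n ih =>
  by_cases h : n < 184
  · rw [onesExcess_eq h]
    exact le_tableExcess n (List.mem_range.2 h) hn
  obtain ⟨j, rfl⟩ := Nat.exists_eq_add_of_le hn
  have h1 := le_mul_onesExcess (n := 120 + j) (by omega)
  rw [Finset.sum_range_add] at h1
  have h2 : -(7500762 * (120 + j : ℤ) ^ 2) ≤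
      ∑ m ∈ Finset.range 120, (divisorSum (120 + j - m) : ℤ) * onesExcess m := by
    rw [← sum_neg_onesExcess, Finset.sum_mul, ← Finset.sum_neg_distrib]
    refine Finset.sum_le_sum fun m _ => ?_
    have s1 : (divisorSum (120 + j - m) : ℤ) ≤ (120 + j : ℤ) ^ 2 := by
      have := (divisorSum_le_sq (120 + j - m)).trans
        (Nat.pow_le_pow_left (Nat.sub_le (120 + j) m) 2)
      exact_mod_cast this
    have s2 : (0 : ℤ) ≤ divisorSum (120 + j - m) := by positivity
    have s3 := le_max_left 0 (-onesExcess m)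
    have s4 := le_max_right 0 (-onesExcess m)
    nlinarith [mul_le_mul_of_nonneg_left s1 s3, mul_le_mul_of_nonneg_left s4 s2]
  have h3 : 75000000 * (j * (j + 1) : ℤ) ≤
      ∑ i ∈ Finset.range j, (divisorSum (120 + j - (120 + i)) : ℤ) * onesExcess (120 + i) := by
    have e : (75000000 * (j * (j + 1) : ℤ)) =
        ∑ i ∈ Finset.range j, 150000000 * ((j - i : ℕ) : ℤ) := by
      rw [← Finset.mul_sum, ← Finset.sum_range_reflect, ← Nat.cast_sum]
      have : ∑ i ∈ Finset.range j, (j - (j - 1 - i)) = ∑ i ∈ Finset.range j, (i + 1) :=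
        Finset.sum_congr rfl fun i hi => by
          rw [Finset.mem_range] at hi
          omega
      rw [this]
      have h4 := Finset.sum_range_id_mul_two (j + 1)
      rw [Finset.sum_range_succ'] at h4
      have h5 : ((∑ i ∈ Finset.range j, (i + 1) : ℕ) : ℤ) * 2 = (j + 1) * j := by
        exact_mod_cast by simpa using h4
      linarith
    rw [e]
    refine Finset.sum_le_sum fun i hi => ?_
    rw [Finset.mem_range] at hi
    have s1 := ih (120 + i) (by omega) (by omega)
    have s2 : ((j - i : ℕ) : ℤ) ≤ divisorSum (120 + j - (120 + i)) := by
      rw [Nat.add_sub_add_left]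
      exact_mod_cast le_divisorSum _
    rw [mul_comm]
    exact mul_le_mul s2 s1 (by norm_num) (by positivity)
  have hj : (64 : ℤ) ≤ j := by exact_mod_cast (by omega : 64 ≤ j)
  have h6 : (150000000 : ℤ) * (120 + j) ≤ (120 + j) * onesExcess (120 + j) := by
    push_cast at h1
    nlinarith
  nlinarith

/-! ### Partitions with a gap above the small parts -/

/-- The condition that every part of `s` larger than `k` is at least `t + l`, where `l` is the
number of parts of `s` that are at most `k`. -/
def HasGap (k t : ℕ) (s : Multiset ℕ) : Prop :=
  ∀ x ∈ s, k < x → t + (s.filter (· ≤ k)).card ≤ x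

/-- The number of partitions of `n` satisfying `HasGap k t`. -/
noncomputable def countGap (k t n : ℕ) : ℕ := partitionCount (HasGap k t) n

theorem countGap_zero (t n : ℕ) : countGap 0 t n = countPartsGE t n := by
  refine partitionCount_congr fun s h0 _ => ?_
  have h : s.filter (· ≤ 0) = 0 := Multiset.filter_eq_nil.2 fun a ha h =>
    h0 ((Nat.le_zero.1 h) ▸ ha)
  unfold HasGap
  rw [h, Multiset.card_zero, add_zero]
  exact ⟨fun H x hx => H x hx (Nat.pos_of_ne_zero fun h => h0 (h ▸ hx)), fun H x hx _ => H x hx⟩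

theorem hasGap_cons_self {k t : ℕ} {s : Multiset ℕ} :
    HasGap k t (k ::ₘ s) ↔ HasGap k (t + 1) s := by
  unfold HasGap
  rw [Multiset.filter_cons_of_pos (p := (· ≤ k)) s le_rfl, Multiset.card_cons]
  simp only [Multiset.mem_cons, forall_eq_or_imp, lt_irrefl, false_imp_iff, true_and]
  exact forall₃_congr fun x _ _ => by rw [add_assoc, add_comm 1]

theorem HasGap.succ_notMem {k t : ℕ} {s : Multiset ℕ} (h : HasGap k t s) (ht : k + 2 ≤ t) :
    k + 1 ∉ s := fun hk => by
  have := h _ hk (by omega)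
  omega

theorem HasGap.succ {k t : ℕ} {s : Multiset ℕ} (h : HasGap k t s) (hk : k + 1 ∉ s) :
    HasGap (k + 1) t s := by
  intro x hx hkx
  have e : s.filter (· ≤ k + 1) = s.filter (· ≤ k) := Multiset.filter_congr fun y hy => by
    have : y ≠ k + 1 := fun h => hk (h ▸ hy)
    omega
  rw [e]
  exact h x hx (by omega)

theorem countGap_le_succ {k t : ℕ} (ht : k + 2 ≤ t) (n : ℕ) :
    countGap k t n ≤ countGap (k + 1) t n :=
  partitionCount_mono fun _ _ _ hs => hs.succ (hs.succ_notMem ht)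

theorem countGap_self_eq {k t : ℕ} (hk : k ≠ 0) (n : ℕ) :
    partitionCount (fun s => k ∈ s ∧ HasGap k t s) (n + k) = countGap k (t + 1) n := by
  rw [partitionCount_mem_and hk]
  exact partitionCount_congr fun s _ _ => hasGap_cons_self

theorem countGap_add_le {k t : ℕ} (ht : k + 2 ≤ t) (n : ℕ) :
    countGap (k + 1) (t + 1) n + countGap k t (n + (k + 1)) ≤
      countGap (k + 1) t (n + (k + 1)) := by
  rw [← countGap_self_eq (Nat.succ_ne_zero k), add_comm]
  exact partitionCount_add_le
    (fun s _ _ hs => ⟨hs.succ (hs.succ_notMem ht), fun h => hs.succ_notMem ht h.1⟩)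
    (fun s _ _ hs => hs.2)

theorem countGap_one_succ_le (t n : ℕ) :
    countGap 1 (t + 1) (n + 1) ≤ countGap 1 (t + 2) n + countPartsGE (t + 1) (n + 1) := by
  rw [← countGap_self_eq (k := 1) (t := t + 1) one_ne_zero]
  unfold countGap countPartsGE
  rw [partitionCount_split (HasGap 1 (t + 1)) (fun s => 1 ∈ s)]
  refine add_le_add le_rfl (partitionCount_mono fun s h0 _ hs x hx => ?_)
  have := hs.2 x hx
  have hx1 : x ≠ 1 := fun h => hs.1 (h ▸ hx)
  have hx0 : x ≠ 0 := fun h => h0 (h ▸ hx)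
  omega

/-- Replacing `l` ones by the single part `l + t` gives a partition with all parts at least `t`. -/
theorem countGap_one_le (t n : ℕ) (ht : t ≠ 0) :
    countGap 1 (t + 1) n ≤ countPartsGE t (n + t) := by
  induction n generalizing t with
  | zero =>
    rw [countPartsGE_add ht]
    have h : countGap 1 (t + 1) 0 ≤ countPartsGE t 0 := partitionCount_mono fun s h0 hs _ => by
      have : s = 0 := Multiset.eq_zero_of_forall_notMem fun a ha => by
        have := Multiset.le_sum_of_mem ha
        exact h0 ((show a = 0 by omega) ▸ ha)
      simp [this]
    omega
  | succ n ih =>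
    have h1 := countGap_one_succ_le t n
    have h2 := ih (t + 1) (by omega)
    rw [show t + 1 + 1 = t + 2 by omega] at h2
    have h3 := countPartsGE_add ht (n + 1)
    have h4 : countPartsGE (t + 1) (n + 1) ≤ countPartsGE t (n + 1) :=
      countPartsGE_anti (Nat.le_succ t) _
    rw [show n + (t + 1) = n + 1 + t by omega] at h2
    omega

theorem card_filter_pos {s : Multiset ℕ} {k x : ℕ} (hx : x ∈ s) (h : x ≤ k) :
    0 < (s.filter (· ≤ k)).card :=
  Multiset.card_pos_iff_exists_mem.2 ⟨x, Multiset.mem_filter.2 ⟨hx, h⟩⟩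

/-- The two values of `countGap` bound the number of partitions in the first class with `k + 1` odd
parts, and `p(j + (k + 1))` counts those in the second class. Partitions counted on the
left are disjoint from those that contain the parts `k + 2, 1, 1`, and a partition
counted twice has all parts at least `k + 1` and contains `k + 1`. -/
theorem countGap_add_countGap_le {k : ℕ} (hk : 1 ≤ k) (j : ℕ) :
    countGap (k + 1) (k + 2) j + countGap k (k + 1) (j + (k + 1)) +
        partitionCount (fun s => {k + 2, 1, 1} ≤ s) (j + (k + 1)) ≤
      partitionNumber (j + (k + 1)) + countPartsGE (k + 1) j := by
  have h1 : countGap k (k + 1) (j + (k + 1)) ≤ countPartsGE (k + 1) j +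
      partitionCount (fun s => k + 1 ∉ s ∧ HasGap k (k + 1) s) (j + (k + 1)) := by
    unfold countGap countPartsGE
    rw [partitionCount_split _ (fun s => k + 1 ∈ s), partitionCount_mem_and (Nat.succ_ne_zero k)]
    refine add_le_add (partitionCount_mono fun s _ _ hs x hx => ?_) le_rfl
    by_contra hxk
    have h2 := hs (k + 1) (Multiset.mem_cons_self _ _) (by omega)
    have h3 := card_filter_pos (Multiset.mem_cons_of_mem (b := k + 1) hx) (show x ≤ k by omega)
    exact Nat.not_le.2 (Nat.lt_add_of_pos_right h3) h2
  have h2 : ∀ s : Multiset ℕ, {k + 2, 1, 1} ≤ s → ∀ m, 1 ≤ m → HasGap m (k + 1) s →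
      k + 2 ≤ m := by
    intro s hs m hm hgap
    by_contra hmk
    have h3 := hgap (k + 2) (Multiset.mem_of_le hs (by simp)) (by omega)
    have h4 := Multiset.card_le_card (Multiset.filter_le_filter (· ≤ m) hs)
    have h5 : (Multiset.filter (· ≤ m) ({k + 2, 1, 1} : Multiset ℕ)).card = 2 := by
      have e : ({k + 2, 1, 1} : Multiset ℕ) = (k + 2) ::ₘ 1 ::ₘ 1 ::ₘ 0 := rfl
      rw [e, Multiset.filter_cons_of_neg (p := (· ≤ m)) _ hmk,
        Multiset.filter_cons_of_pos (p := (· ≤ m)) _ hm,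
        Multiset.filter_cons_of_pos (p := (· ≤ m)) _ hm]
      simp
    omega
  have h3 := partitionCount_add_le (n := j + (k + 1))
    (P := fun s => k + 1 ∈ s ∧ HasGap (k + 1) (k + 1) s)
    (Q := fun s => k + 1 ∉ s ∧ HasGap k (k + 1) s)
    (R := fun s => (k + 1 ∈ s ∧ HasGap (k + 1) (k + 1) s) ∨ (k + 1 ∉ s ∧ HasGap k (k + 1) s))
    (fun s _ _ h => ⟨Or.inl h, fun h' => h'.1 h.1⟩) (fun s _ _ h => Or.inr h)
  have h4 := partitionCount_add_le (n := j + (k + 1))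
    (P := fun s => (k + 1 ∈ s ∧ HasGap (k + 1) (k + 1) s) ∨ (k + 1 ∉ s ∧ HasGap k (k + 1) s))
    (Q := fun s => {k + 2, 1, 1} ≤ s) (R := fun _ => True)
    (fun s _ _ h => ⟨trivial, fun hs => by
      rcases h with h | h
      · have := h2 s hs (k + 1) (by omega) h.2
        omega
      · have := h2 s hs k hk h.2
        omega⟩) (fun s _ _ _ => trivial)
  rw [countGap_self_eq (Nat.succ_ne_zero k), show k.succ = k + 1 from rfl,
    show k + 1 + 1 = k + 2 from rfl] at h3
  change _ ≤ partitionNumber _ at h4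
  omega

/-! ### Even parts above distinct odd parts -/

/-- Doubling all parts identifies partitions of `n` with partitions of `2 * n` into even parts. -/
theorem partitionCount_even (P : Multiset ℕ → Prop) (n : ℕ) :
    partitionCount (fun s => (∀ x ∈ s, Even x) ∧ P s) (2 * n) =
      partitionCount (fun s => P (s.map (2 * ·))) n := by
  classical
  symm
  refine Finset.card_bij (fun s _ => s.map (2 * ·)) ?_ ?_ ?_
  · intro s hs
    simp only [Finset.mem_filter, mem_partitionMultisets] at hs ⊢
    obtain ⟨⟨h0, hn⟩, hP⟩ := hs
    refine ⟨⟨?_, ?_⟩, ?_, hP⟩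
    · simpa using h0
    · rw [Multiset.sum_map_mul_left, Multiset.map_id', hn]
    · simp
  · intro s _ s' _ h
    exact Multiset.map_injective (fun a b h => by simpa using h) h
  · intro s hs
    simp only [Finset.mem_filter, mem_partitionMultisets] at hs
    obtain ⟨⟨h0, hn⟩, hev, hP⟩ := hs
    have e : (s.map (· / 2)).map (2 * ·) = s := by
      rw [Multiset.map_map]
      conv_rhs => rw [← Multiset.map_id s]
      exact Multiset.map_congr rfl fun x hx => Nat.mul_div_cancel' (hev x hx).two_dvd
    have e2 := congrArg Multiset.sum e
    rw [Multiset.sum_map_mul_left, Multiset.map_id'] at e2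
    refine ⟨s.map (· / 2), ?_, e⟩
    simp only [Finset.mem_filter, mem_partitionMultisets]
    refine ⟨⟨fun h => h0 ?_, by omega⟩, by rwa [e]⟩
    rw [← e]
    exact Multiset.mem_map.2 ⟨0, h, rfl⟩

/-- The condition on a multiset of parts that defines `partitionsOdEu`. -/
def IsOdEu (s : Multiset ℕ) : Prop :=
  (s.filter fun a => Odd a).Nodup ∧ ∀ a ∈ s, ∀ b ∈ s, Even a → Odd b → b < a

/-- The number of partitions of `n` in the class `partitionsOdEu` with exactly `k` odd parts and
all parts at least `2 * i`. -/
noncomputable def countOdEu (i k n : ℕ) : ℕ :=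
  partitionCount (fun s => IsOdEu s ∧ (s.filter fun a => Odd a).card = k ∧ ∀ x ∈ s, 2 * i ≤ x) n

theorem forall_even_of_card_filter_odd {s : Multiset ℕ}
    (h : (s.filter fun a => Odd a).card = 0) : ∀ x ∈ s, Even x := fun x hx => by
  rw [Multiset.card_eq_zero, Multiset.filter_eq_nil] at h
  exact Nat.not_odd_iff_even.1 (h x hx)

theorem even_sum_of_forall_even {s : Multiset ℕ} (h : ∀ x ∈ s, Even x) : Even s.sum :=
  even_iff_two_dvd.2 (Multiset.dvd_sum fun x hx => (h x hx).two_dvd)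

theorem countOdEu_zero_le (i n : ℕ) : countOdEu i 0 (2 * n) ≤ countPartsGE i n := by
  have h := partitionCount_even (fun s => ∀ x ∈ s, 2 * i ≤ x) n
  have h2 : partitionCount (fun s => ∀ x ∈ s.map (2 * ·), 2 * i ≤ x) n = countPartsGE i n :=
    partitionCount_congr fun s _ _ => by simp
  rw [← h2, ← h]
  exact partitionCount_mono fun s _ _ hs => ⟨forall_even_of_card_filter_odd hs.2.1, hs.2.2⟩

theorem countOdEu_zero_odd {n : ℕ} (hn : Odd n) (i : ℕ) : countOdEu i 0 n = 0 :=
  partitionCount_eq_zero fun s _ hsum hs => by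
    have := even_sum_of_forall_even (forall_even_of_card_filter_odd hs.2.1)
    rw [hsum] at this
    exact Nat.not_even_iff_odd.2 hn this

theorem exists_odd_of_card_filter_odd {s : Multiset ℕ} {k : ℕ}
    (h : (s.filter fun a => Odd a).card = k + 1) : ∃ x ∈ s, Odd x := by
  obtain ⟨x, hx⟩ := Multiset.card_pos_iff_exists_mem.1 (by rw [h]; exact Nat.succ_pos k)
  exact ⟨x, Multiset.mem_filter.1 hx⟩

theorem countOdEu_succ_eq_zero {i n : ℕ} (k : ℕ) (hn : n ≤ 2 * i) : countOdEu i (k + 1) n = 0 :=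
  partitionCount_eq_zero fun s _ hsum hs => by
    obtain ⟨x, hx, hodd⟩ := exists_odd_of_card_filter_odd hs.2.1
    have h1 := hs.2.2 x hx
    have h2 := Multiset.le_sum_of_mem hx
    obtain ⟨y, rfl⟩ := hodd
    omega

/-- If the odd part `2 * i + 1` is absent, then all parts are at least `2 * i + 2`, since the even
parts exceed some odd part. -/
theorem countOdEu_notMem_le (i k n : ℕ) :
    partitionCount (fun s => 2 * i + 1 ∉ s ∧ IsOdEu s ∧ (s.filter fun a => Odd a).card = k + 1 ∧
      ∀ x ∈ s, 2 * i ≤ x) n ≤ countOdEu (i + 1) (k + 1) n := by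
  refine partitionCount_mono fun s _ _ hs => ⟨hs.2.1, hs.2.2.1, ?_⟩
  obtain ⟨hi, hs, hcard, hle⟩ := hs
  have hodd : ∀ x ∈ s, Odd x → 2 * (i + 1) < x := fun x hx hx' => by
    have h1 := hle x hx
    have h2 : x ≠ 2 * i + 1 := fun h => hi (h ▸ hx)
    obtain ⟨y, rfl⟩ := hx'
    omega
  intro x hx
  rcases Nat.even_or_odd x with he | ho
  · obtain ⟨y, hy, hy'⟩ := exists_odd_of_card_filter_odd hcard
    exact ((hodd y hy hy').trans (hs.2 x hx y hy he hy')).le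
  · exact (hodd x hx ho).le

theorem countOdEu_add_le (i k n : ℕ) :
    countOdEu i (k + 1) (n + (2 * i + 1)) ≤
      countOdEu (i + 1) (k + 1) (n + (2 * i + 1)) + countOdEu (i + 1) k n := by
  rw [countOdEu, partitionCount_split _ (fun s => 2 * i + 1 ∈ s),
    partitionCount_mem_and (Nat.succ_ne_zero _), add_comm]
  refine add_le_add (countOdEu_notMem_le i k _) (partitionCount_mono fun s _ _ hs => ?_)
  have hodd : Odd (2 * i + 1) := ⟨i, rfl⟩
  obtain ⟨⟨hnd, hlt⟩, hcard, hle⟩ := hs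
  rw [Multiset.filter_cons_of_pos _ hodd] at hnd hcard
  rw [Multiset.nodup_cons] at hnd
  rw [Multiset.card_cons] at hcard
  refine ⟨⟨hnd.2, fun a ha b hb => hlt a (Multiset.mem_cons_of_mem ha) b
    (Multiset.mem_cons_of_mem hb)⟩, Nat.succ_injective hcard, fun x hx => ?_⟩
  rcases Nat.even_or_odd x with he | ho
  · have := hlt x (Multiset.mem_cons_of_mem hx) _ (Multiset.mem_cons_self _ _) he hodd
    omega
  · have h1 := hle x (Multiset.mem_cons_of_mem hx)
    have h2 : x ≠ 2 * i + 1 := fun h => hnd.1 (Multiset.mem_filter.2 ⟨h ▸ hx, hodd⟩)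
    obtain ⟨y, rfl⟩ := ho
    omega

/-- Sending the `k` odd parts to the numbers of odd parts above each missing odd number, and halving
the even parts, gives a partition with a gap. The proof runs this correspondence one odd number
at a time. -/
theorem countOdEu_le_countGap (i k n : ℕ) (hi : 1 ≤ i) :
    (∃ N, n = 2 * N + k ^ 2 + 2 * i * k ∧ countOdEu i k n ≤ countGap k (i + k) N) ∨
      countOdEu i k n = 0 := by
  induction h : n - 2 * i using Nat.strong_induction_on generalizing i k n with
  | _ m ih =>
  subst h
  cases k with
  | zero =>
    rcases Nat.even_or_odd' n with ⟨N, rfl | rfl⟩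
    · refine Or.inl ⟨N, by ring, ?_⟩
      rw [countGap_zero]
      exact countOdEu_zero_le i N
    · exact Or.inr (countOdEu_zero_odd ⟨N, rfl⟩ i)
  | succ k =>
    by_cases hn : n ≤ 2 * i
    · exact Or.inr (countOdEu_succ_eq_zero k hn)
    obtain ⟨n, rfl⟩ : ∃ n', n = n' + (2 * i + 1) := ⟨n - (2 * i + 1), by omega⟩
    have hrec := countOdEu_add_le i k n
    have h1 := ih _ (by omega) (i + 1) (k + 1) (n + (2 * i + 1)) (by omega) rfl
    have h2 := ih _ (by omega) (i + 1) k n (by omega) rfl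
    rcases h2 with ⟨N, hN, h2⟩ | h2
    · refine Or.inl ⟨N, by rw [hN]; ring, ?_⟩
      rw [show i + 1 + k = i + (k + 1) by ring] at h2
      rcases h1 with ⟨N', hN', h1⟩ | h1
      · have hNN : N = N' + (k + 1) := by
          rw [hN] at hN'
          nlinarith
        have h3 := countGap_add_le (k := k) (t := i + (k + 1)) (by omega) N'
        rw [show i + 1 + (k + 1) = i + (k + 1) + 1 by ring] at h1
        rw [← hNN] at h3
        omega
      · have h3 := countGap_le_succ (k := k) (t := i + (k + 1)) (by omega) N
        omega
    · rcases h1 with ⟨N, hN, h1⟩ | h1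
      · refine Or.inl ⟨N + (k + 1), by rw [hN]; ring, ?_⟩
        have h3 := countGap_add_le (k := k) (t := i + (k + 1)) (by omega) N
        rw [show i + 1 + (k + 1) = i + (k + 1) + 1 by ring] at h1
        omega
      · exact Or.inr (by omega)

/-! ### Distinct odd parts above even parts -/

/-- The number of partitions of `n` into parts that are at most `m`. -/
noncomputable def countPartsLE (m n : ℕ) : ℕ := partitionCount (fun s => ∀ x ∈ s, x ≤ m) n

theorem countPartsLE_succ_add_le (m n : ℕ) :
    countPartsLE (m + 1) (n + (m + 1)) ≤ countPartsLE m (n + (m + 1)) + countPartsLE (m + 1) n := by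
  unfold countPartsLE
  rw [partitionCount_split _ (fun s => m + 1 ∈ s), partitionCount_mem_and (Nat.succ_ne_zero m),
    add_comm]
  refine add_le_add (partitionCount_mono fun s _ _ hs x hx => ?_)
    (partitionCount_mono fun s _ _ hs x hx => hs x (Multiset.mem_cons_of_mem hx))
  have h1 := hs.2 x hx
  have h2 : x ≠ m + 1 := fun h => hs.1 (h ▸ hx)
  omega

theorem countPartsLE_succ_of_lt {m n : ℕ} (h : n < m + 1) :
    countPartsLE (m + 1) n ≤ countPartsLE m n :=
  partitionCount_mono fun s _ hs _ x hx => by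
    have := Multiset.le_sum_of_mem hx
    omega

theorem countPartsLE_self (n : ℕ) : countPartsLE n n = partitionNumber n :=
  partitionCount_congr fun _ _ hs => ⟨fun _ => trivial, fun _ _ hx =>
    hs ▸ Multiset.le_sum_of_mem hx⟩

/-- The condition on a multiset of parts that defines `partitionsEuOd`. -/
def IsEuOd (s : Multiset ℕ) : Prop :=
  (s.filter fun a => Odd a).Nodup ∧ ∀ a ∈ s, ∀ b ∈ s, Even a → Odd b → a < b

/-- The number of partitions of `n` in the class `partitionsEuOd` with exactly `k` odd parts and
all parts at most `2 * m`. -/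
noncomputable def countEuOd (m k n : ℕ) : ℕ :=
  partitionCount (fun s => IsEuOd s ∧ (s.filter fun a => Odd a).card = k ∧ ∀ x ∈ s, x ≤ 2 * m) n

theorem countEuOd_mono (m k n : ℕ) : countEuOd m k n ≤ countEuOd (m + 1) k n :=
  partitionCount_mono fun s _ _ hs => ⟨hs.1, hs.2.1, fun x hx => by
    have := hs.2.2 x hx
    omega⟩

theorem add_le_countEuOd (m k n : ℕ) :
    countEuOd m (k + 1) (n + (2 * m + 1)) + countEuOd m k n ≤
      countEuOd (m + 1) (k + 1) (n + (2 * m + 1)) := by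
  conv_rhs => rw [countEuOd, partitionCount_split _ (fun s => 2 * m + 1 ∈ s),
    partitionCount_mem_and (Nat.succ_ne_zero _)]
  rw [add_comm]
  have hodd : Odd (2 * m + 1) := ⟨m, rfl⟩
  refine add_le_add (partitionCount_mono fun s _ _ hs => ?_)
    (partitionCount_mono fun s _ _ hs => ⟨fun h => ?_, hs.1, hs.2.1, fun x hx => ?_⟩)
  · obtain ⟨⟨hnd, hlt⟩, hcard, hle⟩ := hs
    refine ⟨⟨?_, ?_⟩, ?_, ?_⟩
    · rw [Multiset.filter_cons_of_pos _ hodd, Multiset.nodup_cons]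
      refine ⟨fun h => ?_, hnd⟩
      have := hle _ (Multiset.mem_filter.1 h).1
      omega
    · intro a ha b hb hae hbo
      rcases Multiset.mem_cons.1 ha with rfl | ha
      · exact absurd hodd (Nat.not_odd_iff_even.2 hae)
      · rcases Multiset.mem_cons.1 hb with rfl | hb
        · have := hle a ha
          omega
        · exact hlt a ha b hb hae hbo
    · rw [Multiset.filter_cons_of_pos _ hodd, Multiset.card_cons, hcard]
    · intro x hx
      rcases Multiset.mem_cons.1 hx with rfl | hx
      · omega
      · have := hle x hx
        omega
  · have := hs.2.2 _ h
    omega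
  · have := hs.2.2 x hx
    omega

theorem countPartsLE_le_countEuOd_zero (m n : ℕ) : countPartsLE m n ≤ countEuOd m 0 (2 * n) := by
  have h := partitionCount_even (fun s => ∀ x ∈ s, x ≤ 2 * m) n
  have h2 : partitionCount (fun s => ∀ x ∈ s.map (2 * ·), x ≤ 2 * m) n = countPartsLE m n :=
    partitionCount_congr fun s _ _ => by simp
  rw [← h2, ← h]
  refine partitionCount_mono fun s _ _ hs => ?_
  have hno : ∀ x ∈ s, ¬ Odd x := fun x hx => Nat.not_odd_iff_even.2 (hs.1 x hx)
  have hf : (s.filter fun a => Odd a) = 0 := Multiset.filter_eq_nil.2 hno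
  exact ⟨⟨by simp [hf], fun a _ b hb _ hbo => absurd hbo (hno b hb)⟩, by simp [hf], hs.2⟩

/-- The partitions in the second class with `k` odd parts are counted by the coefficients of
`q ^ (k ^ 2) / ∏ (1 - q ^ (2 i))`; here with the additional bound `2 * (m + k)` on the parts. -/
theorem countPartsLE_le_countEuOd (m k n : ℕ) :
    countPartsLE m n ≤ countEuOd (m + k) k (2 * n + k ^ 2) := by
  induction k generalizing m n with
  | zero => simpa using countPartsLE_le_countEuOd_zero m n
  | succ k ihk =>
    have hstep : ∀ m n, countEuOd (m + k) (k + 1) (2 * n + k ^ 2 + (2 * (m + k) + 1)) +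
        countPartsLE m n ≤ countEuOd (m + (k + 1)) (k + 1) (2 * n + k ^ 2 + (2 * (m + k) + 1)) :=
      fun m n => (add_le_add le_rfl (ihk m n)).trans (add_le_countEuOd (m + k) k _)
    induction m generalizing n with
    | zero =>
      have h := hstep 0 n
      rw [show 2 * n + k ^ 2 + (2 * (0 + k) + 1) = 2 * n + (k + 1) ^ 2 by ring] at h
      omega
    | succ m ihm =>
      have h1 := ihm n
      rw [show m + (k + 1) = m + 1 + k by ring] at h1
      by_cases hn : n < m + 1
      · have h2 := countEuOd_mono (m + 1 + k) (k + 1) (2 * n + (k + 1) ^ 2)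
        exact (countPartsLE_succ_of_lt hn).trans (h1.trans h2)
      · obtain ⟨j, rfl⟩ : ∃ j, n = j + (m + 1) := ⟨n - (m + 1), by omega⟩
        have h2 := hstep (m + 1) j
        rw [show 2 * j + k ^ 2 + (2 * (m + 1 + k) + 1) = 2 * (j + (m + 1)) + (k + 1) ^ 2 by ring]
          at h2
        have h3 := countPartsLE_succ_add_le m j
        omega

/-! ### Comparison of the two classes by the number of odd parts -/

/-- The number of partitions of `n` in the class `partitionsOdEu` with exactly `k` odd parts. -/
noncomputable def oddCountOdEu (k n : ℕ) : ℕ :=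
  partitionCount (fun s => IsOdEu s ∧ (s.filter fun a => Odd a).card = k) n

/-- The number of partitions of `n` in the class `partitionsEuOd` with exactly `k` odd parts. -/
noncomputable def oddCountEuOd (k n : ℕ) : ℕ :=
  partitionCount (fun s => IsEuOd s ∧ (s.filter fun a => Odd a).card = k) n

theorem partitionCount_eq_sum (P : Multiset ℕ → Prop) (n : ℕ) :
    partitionCount P n = ∑ k ∈ Finset.range (n + 1),
      partitionCount (fun s => P s ∧ (s.filter fun a => Odd a).card = k) n := by
  classical
  unfold partitionCount
  rw [Finset.card_eq_sum_card_fiberwise (f := fun s : Multiset ℕ => (s.filter fun a => Odd a).card)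
    (t := Finset.range (n + 1))]
  · refine Finset.sum_congr rfl fun k _ => ?_
    rw [Finset.filter_filter]
    congr
  · intro s hs
    obtain ⟨h0, hn⟩ := mem_partitionMultisets.1 (Finset.mem_filter.1 hs).1
    have h1 := Multiset.card_le_card (Multiset.filter_le (fun a => Odd a) s)
    have h2 := Multiset.card_nsmul_le_sum (s := s) (a := 1) fun x hx =>
      Nat.pos_of_ne_zero fun h => h0 (h ▸ hx)
    rw [smul_eq_mul, mul_one] at h2
    simp only [Finset.coe_range, Set.mem_Iio]
    omega

theorem pOdEu_eq_sum (n : ℕ) : pOdEu n = ∑ k ∈ Finset.range (n + 1), oddCountOdEu k n := by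
  unfold oddCountOdEu
  rw [← partitionCount_eq_sum, ← card_filter_partition, pOdEu, partitionsOdEu]
  congr

theorem pEuOd_eq_sum (n : ℕ) : pEuOd n = ∑ k ∈ Finset.range (n + 1), oddCountEuOd k n := by
  unfold oddCountEuOd
  rw [← partitionCount_eq_sum, ← card_filter_partition, pEuOd, partitionsEuOd]
  congr

theorem partitionNumber_le_oddCountEuOd (k n : ℕ) :
    partitionNumber n ≤ oddCountEuOd k (2 * n + k ^ 2) := by
  rw [← countPartsLE_self]
  exact (countPartsLE_le_countEuOd n k n).trans
    (partitionCount_mono fun _ _ _ hs => ⟨hs.1, hs.2.1⟩)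

theorem oddCountOdEu_eq (k n : ℕ) : oddCountOdEu k n = countOdEu 0 k n :=
  partitionCount_congr fun _ _ _ => ⟨fun h => ⟨h.1, h.2, fun _ _ => by omega⟩,
    fun h => ⟨h.1, h.2.1⟩⟩

theorem oddCountOdEu_zero_le (n : ℕ) : oddCountOdEu 0 (2 * n) ≤ partitionNumber n := by
  rw [oddCountOdEu_eq]
  exact (countOdEu_zero_le 0 n).trans (partitionCount_le_partitionNumber _ _)

theorem oddCountOdEu_zero_odd {n : ℕ} (hn : Odd n) : oddCountOdEu 0 n = 0 := by
  rw [oddCountOdEu_eq]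
  exact countOdEu_zero_odd hn 0

theorem oddCountOdEu_succ_le (k n : ℕ) :
    oddCountOdEu (k + 1) (n + 1) ≤ countOdEu 1 (k + 1) (n + 1) + countOdEu 1 k n := by
  rw [oddCountOdEu_eq]
  exact countOdEu_add_le 0 k n

theorem oddCountOdEu_eq_zero {k n : ℕ} (h : ∀ N, n ≠ 2 * N + (k + 1) ^ 2) :
    oddCountOdEu (k + 1) n = 0 := by
  cases n with
  | zero =>
    rw [oddCountOdEu_eq]
    exact countOdEu_succ_eq_zero k le_rfl
  | succ n =>
    have h0 := oddCountOdEu_succ_le k n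
    rcases countOdEu_le_countGap 1 (k + 1) (n + 1) le_rfl with ⟨N, hN, -⟩ | h1
    · exact absurd (hN.trans (by ring)) (h (N + (k + 1)))
    · rcases countOdEu_le_countGap 1 k n le_rfl with ⟨N, rfl, -⟩ | h2
      · exact absurd (by ring) (h N)
      · omega

theorem countOdEu_one_le (k n : ℕ) :
    countOdEu 1 k (2 * n + k ^ 2 + 2 * k) ≤ countGap k (k + 1) n := by
  rcases countOdEu_le_countGap 1 k (2 * n + k ^ 2 + 2 * k) le_rfl with ⟨N, hN, h⟩ | h
  · obtain rfl : n = N := by omega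
    rwa [add_comm k]
  · omega

/-- The partitions of the first class with `k + 1` odd parts, split according to the presence of
the part `1`. -/
theorem oddCountOdEu_le (k j : ℕ) :
    oddCountOdEu (k + 1) (2 * (j + (k + 1)) + (k + 1) ^ 2) ≤
      countGap (k + 1) (k + 2) j + countGap k (k + 1) (j + (k + 1)) := by
  have h0 := oddCountOdEu_succ_le k (2 * (j + (k + 1)) + k ^ 2 + 2 * k)
  have h1 := countOdEu_one_le (k + 1) j
  have h2 := countOdEu_one_le k (j + (k + 1))
  rw [show 2 * (j + (k + 1)) + k ^ 2 + 2 * k + 1 = 2 * (j + (k + 1)) + (k + 1) ^ 2 by ring] at h0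
  rw [show 2 * j + (k + 1) ^ 2 + 2 * (k + 1) = 2 * (j + (k + 1)) + (k + 1) ^ 2 by ring] at h1
  exact h0.trans (add_le_add h1 h2)

theorem oddCountOdEu_le_of_lt {k n : ℕ} (h : n < k + 1) :
    oddCountOdEu (k + 1) (2 * n + (k + 1) ^ 2) ≤ partitionNumber n := by
  have h0 := oddCountOdEu_succ_le k (2 * n + k ^ 2 + 2 * k)
  have h2 := countOdEu_one_le k n
  rw [show 2 * n + k ^ 2 + 2 * k + 1 = 2 * n + (k + 1) ^ 2 by ring] at h0
  have h3 : countGap k (k + 1) n ≤ partitionNumber n := partitionCount_le_partitionNumber _ _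
  rcases countOdEu_le_countGap 1 (k + 1) (2 * n + (k + 1) ^ 2) le_rfl with ⟨N, hN, -⟩ | h1
  · omega
  · omega

theorem oddCountOdEu_add_le {k : ℕ} (hk : 1 ≤ k) (j : ℕ) :
    oddCountOdEu (k + 1) (2 * (j + 3 + (k + 1)) + (k + 1) ^ 2) + partitionNumber j ≤
      partitionNumber (j + 3 + (k + 1)) + countPartsGE (k + 1) (j + 3) := by
  have h1 := oddCountOdEu_le k (j + 3)
  have h2 := countGap_add_countGap_le hk (j + 3)
  have h3 := partitionCount_le {k + 2, 1, 1} (by simp) j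
  rw [show j + ({k + 2, 1, 1} : Multiset ℕ).sum = j + 3 + (k + 1) by simp; omega] at h3
  omega

/-- With at least four odd parts, the first class has at most as many members as the second one,
except for one additional member if `n = k ^ 2 + 2 * k`. -/
theorem oddCountOdEu_le_oddCountEuOd (k n : ℕ) :
    oddCountOdEu (k + 4) n ≤ oddCountEuOd (k + 4) n +
      if n = (k + 4) ^ 2 + 2 * (k + 4) then 1 else 0 := by
  by_cases h : ∃ N, n = 2 * N + (k + 4) ^ 2
  swap
  · rw [oddCountOdEu_eq_zero (k := k + 3) (not_exists.1 h)]
    exact Nat.zero_le _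
  obtain ⟨N, rfl⟩ := h
  have h0 := partitionNumber_le_oddCountEuOd (k + 4) N
  by_cases hN : N < k + 4
  · have := oddCountOdEu_le_of_lt (k := k + 3) hN
    exact (this.trans h0).trans (Nat.le_add_right _ _)
  obtain ⟨j, rfl⟩ : ∃ j, N = j + (k + 4) := ⟨N - (k + 4), by omega⟩
  by_cases hj : 3 < j
  · obtain ⟨i, rfl⟩ : ∃ i, j = i + 1 + 3 := ⟨j - 4, by omega⟩
    have h1 := oddCountOdEu_add_le (k := k + 3) (by omega) (i + 1)
    have h2 := countPartsGE_add_le (k := k + 1) 3 i (by omega)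
    have h3 : countPartsGE (k + 1) (i + 1) ≤ partitionNumber (i + 1) :=
      partitionCount_le_partitionNumber _ _
    rw [show k + 1 + 3 = k + 3 + 1 by ring, show i + 3 + 1 = i + 1 + 3 by ring] at h2
    rw [show k + 4 = k + 3 + 1 by ring] at h0 ⊢
    omega
  · have h1 := oddCountOdEu_le (k + 3) j
    have h2 := countGap_add_countGap_le (k := k + 3) (by omega) j
    have h3 : countPartsGE (k + 4) j ≤ if j = 0 then 1 else 0 := by
      split_ifs with hj0
      · rw [hj0]
        exact countPartsGE_zero_right _
      · rw [countPartsGE_eq_zero hj0 (by omega)]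
    have h4 : (if 2 * (j + (k + 4)) + (k + 4) ^ 2 = (k + 4) ^ 2 + 2 * (k + 4) then 1 else 0) =
        if j = 0 then 1 else 0 := if_congr (by omega) rfl rfl
    rw [h4]
    rw [show k + 3 + 1 = k + 4 by ring] at *
    omega

theorem countPartsGE_two_add_le {n : ℕ} (hn : 120 ≤ n) :
    countPartsGE 2 n + countPartsGE 2 (n - 1) + countPartsGE 2 (n - 7) + 2 ≤
      partitionNumber (n - 10) := by
  have h := le_onesExcess hn
  have hs : ∀ d, d ≤ n → shiftedPartitionNumber d n = partitionNumber (n - d) :=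
    fun d hd => if_pos hd
  rw [onesExcess, hs 10 (by omega), hs 0 (by omega), hs 2 (by omega), hs 7 (by omega),
    hs 8 (by omega), Nat.sub_zero] at h
  have h1 := partitionNumber_succ (n - 1)
  have h2 := partitionNumber_succ (n - 2)
  have h3 := partitionNumber_succ (n - 8)
  rw [show n - 1 + 1 = n by omega] at h1
  rw [show n - 2 + 1 = n - 1 by omega] at h2
  rw [show n - 8 + 1 = n - 7 by omega] at h3
  omega

/-- The partitions with at most three odd parts decide the comparison. -/
theorem sum_oddCountOdEu_add_two_le {n : ℕ} (hn : 373 ≤ n) :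
    ∑ k ∈ Finset.range 4, oddCountOdEu k n + 2 ≤ ∑ k ∈ Finset.range 4, oddCountEuOd k n := by
  simp only [Finset.sum_range_succ, Finset.sum_range_zero, zero_add]
  rcases Nat.even_or_odd' n with ⟨N, rfl | rfl⟩
  · have e1 := oddCountOdEu_eq_zero (k := 0) (n := 2 * N) fun _ => by omega
    have e3 := oddCountOdEu_eq_zero (k := 2) (n := 2 * N) fun _ => by omega
    have h0 := oddCountOdEu_zero_le N
    have h0' := partitionNumber_le_oddCountEuOd 0 N
    have h2 := oddCountOdEu_add_le (k := 1) le_rfl (N - 7)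
    have h2' := partitionNumber_le_oddCountEuOd 2 (N - 2)
    have h3 := countPartsGE_two_add_le (n := N - 4) (by omega)
    have h4 : partitionNumber (N - 4 - 10) ≤ partitionNumber (N - 7) :=
      partitionNumber_mono (by omega)
    simp only [Nat.reduceAdd, Nat.reducePow, zero_add, add_zero, ne_eq, OfNat.ofNat_ne_zero,
      not_false_eq_true, zero_pow] at *
    rw [show 2 * (N - 7 + 3 + 2) + 4 = 2 * N by omega, show N - 7 + 3 + 2 = N - 2 by omega,
      show N - 7 + 3 = N - 4 by omega] at h2
    rw [show 2 * (N - 2) + 4 = 2 * N by omega] at h2'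
    omega
  · have e0 := oddCountOdEu_zero_odd (n := 2 * N + 1) ⟨N, rfl⟩
    have e2 := oddCountOdEu_eq_zero (k := 1) (n := 2 * N + 1) fun _ => by omega
    have h1 := oddCountOdEu_le 0 (N - 1)
    have h1' := partitionNumber_le_oddCountEuOd 1 N
    have h3 := oddCountOdEu_add_le (k := 2) one_le_two (N - 10)
    have h3' := partitionNumber_le_oddCountEuOd 3 (N - 4)
    have h4 := countPartsGE_two_add_le (n := N) (by omega)
    have h5 := countGap_one_succ_le 1 (N - 2)
    have h6 := countGap_one_le 2 (N - 2) two_ne_zero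
    have h7 := countPartsGE_anti (show 2 ≤ 3 by omega) (N - 7)
    rw [countGap_zero, zero_add, countPartsGE_one] at h1
    simp only [Nat.reduceAdd, Nat.reducePow, zero_add] at *
    rw [show 2 * (N - 1 + 1) + 1 = 2 * N + 1 by omega, show N - 1 + 1 = N by omega] at h1
    rw [show 2 * (N - 10 + 3 + 3) + 9 = 2 * N + 1 by omega, show N - 10 + 3 + 3 = N - 4 by omega,
      show N - 10 + 3 = N - 7 by omega] at h3
    rw [show 2 * (N - 4) + 9 = 2 * N + 1 by omega] at h3'
    rw [show N - 2 + 1 = N - 1 by omega] at h5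
    rw [show N - 2 + 2 = N by omega] at h6
    omega

theorem theorem1 (n : ℕ) (hn : 373 ≤ n) : pOdEu n < pEuOd n := by
  obtain ⟨m, hm⟩ : ∃ m, n + 1 = 4 + m := ⟨n - 3, by omega⟩
  rw [pOdEu_eq_sum, pEuOd_eq_sum, hm, Finset.sum_range_add, Finset.sum_range_add]
  have h1 := sum_oddCountOdEu_add_two_le hn
  have h2 := Finset.sum_le_sum fun k (_ : k ∈ Finset.range m) => oddCountOdEu_le_oddCountEuOd k n
  rw [Finset.sum_add_distrib, ← Finset.card_filter] at h2
  -- The map `k ↦ k ^ 2 + 2 * k` is injective, so at most one exceptional partition arises.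
  have h3 : ((Finset.range m).filter fun k => n = (k + 4) ^ 2 + 2 * (k + 4)).card ≤ 1 := by
    refine Finset.card_le_one.2 fun a ha b hb => ?_
    have ha := (Finset.mem_filter.1 ha).2
    have hb := (Finset.mem_filter.1 hb).2
    nlinarith
  simp only [add_comm 4]
  omega
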